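/- Let $\mathcal H$ be a complex Hilbert space carrying a continuous unitary representation $\pi$ of the Jacobi group $G^J_1=H_1\rtimes SU(1,1)$ (or of a connected covering group of it). On the smooth vectors of $\pi$ the derived representation gives operators $a,a^\dagger,K_0,K_\pm$ with $(a^\dagger)^\dagger=a$, $K_0^\dagger=K_0$, $K_\pm^\dagger=K_\mp$ and $$[a,a^\dagger]=1,\quad [K_0,K_\pm]=\pm K_\pm,\quad [K_-,K_+]=2K_0,\quad [a,K_+]=a^\dagger,\quad [K_-,a^\dagger]=a,$$ $$[K_+,a^\dagger]=[K_-,a]=0,\quad [K_0,a^\dagger]=\tfrac12a^\dagger,\quad [K_0,a]=-\tfrac12a.$$ Let $e_0$ be a smooth unit vector with $ae_0=0$, $K_-e_0=0$, $K_0e_0=ke_0$, where $k>0$, and let $\mu>0$. For $\eta,z,w\in\mathbb C$ with $|w|<1$ put $$D_\mu(\eta)=\exp\bigl(\sqrt\mu(\eta a^\dagger-\bar\eta a)\bigr),\qquad S_k(w)=\exp(\zeta K_+-\bar\zeta K_-),\quad w=\tfrac{\zeta}{|\zeta|}\tanh|\zeta|\quad(\zeta=0\text{ if }w=0),$$ (unitary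 operators of the representation), $\underline e_{\eta,w}=D_\mu(\eta)S_k(w)e_0$, and $e_{z,w}=\exp(\sqrt\mu\,za^\dagger+wK_+)e_0$ (a norm-convergent exponential series). Then, for $\eta\in\mathbb C$ and $|w|<1$, $$\underline e_{\eta,w}=(1-|w|^2)^k\exp(-\tfrac12\mu\bar\eta z)\,e_{z,w},\qquad z=\eta-w\bar\eta,$$ and, for $z\in\mathbb C$ and $|w|<1$, $$e_{z,w}=(1-|w|^2)^{-k}\exp(\tfrac12\mu\bar\eta z)\,\underline e_{\eta,w},\qquad \eta=\frac{z+\bar zw}{1-|w|^2}.$$ The map $FC(\eta,w)=(\eta-w\bar\eta,\,w)$ is a diffeomorphism of the Siegel–Jacobi disk $\mathcal D^J_1=\mathbb C\times\{|w|<1\}$ onto itself, with inverse $(z,w)\mapsto\bigl((z+\bar zw)/(1-|w|^2),\,w\bigr)$, and it is an $FC$-transform for these coherent states: if $(z,w)=FC(\eta,w)$, then the unit vectors $\underline e_{\eta,w}$ and $\tilde e_{z,w}=(e_{z,w},e_{z,w})^{-1/2}e_{z,w}$ define the same state, namely $$\underline e_{\eta,w}=\exp\bigl(-\tfrac{\mathrm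 i}{2}\mu\,\mathrm{Im}(\bar\eta z)\bigr)\,\tilde e_{z,w}.$$ -/

import Mathlib

open scoped ComplexConjugate ContDiff

noncomputable section

namespace SiegelJacobi

/-- Elements `i s 1 + α a† - ᾱ a + 2 i θ K₀ + y K₊ - ȳ K₋` of the real Jacobi algebra, the
semidirect sum of the Heisenberg algebra and `su(1,1)`, in the real coordinates `(s, α, θ, y)`. -/
abbrev JacobiAlgebra : Type := ℝ × ℂ × ℝ × ℂ

/-- A `*`-representation of the Jacobi algebra on a dense subspace (the smooth vectors) of a complex
Hilbert space: operators representing the generators `a, a†, K₀, K₊, K₋`, which leave the dense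
subspace invariant, satisfy the commutation relations of the algebra and are mutually adjoint
there. -/
structure DerivedRep (H : Type*) [NormedAddCommGroup H] [InnerProductSpace ℂ H] where
  /-- the space of smooth vectors -/
  smooth : Submodule ℂ H
  dense_smooth : Dense (smooth : Set H)
  /-- annihilation operator -/
  a : Module.End ℂ smooth
  /-- creation operator -/
  ad : Module.End ℂ smooth
  K0 : Module.End ℂ smooth
  Kp : Module.End ℂ smooth
  Km : Module.End ℂ smooth
  comm_a_ad : a * ad - ad * a = 1
  comm_K0_Kp : K0 * Kp - Kp * K0 = Kp
  comm_K0_Km : K0 * Km - Km * K0 = -Km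
  comm_Km_Kp : Km * Kp - Kp * Km = (2 : ℂ) • K0
  comm_a_Kp : a * Kp - Kp * a = ad
  comm_Km_ad : Km * ad - ad * Km = a
  comm_Kp_ad : Kp * ad - ad * Kp = 0
  comm_Km_a : Km * a - a * Km = 0
  comm_K0_ad : K0 * ad - ad * K0 = (1 / 2 : ℂ) • ad
  comm_K0_a : K0 * a - a * K0 = -((1 / 2 : ℂ) • a)
  adjoint_a : ∀ u v : smooth, inner ℂ (a u : H) (v : H) = inner ℂ (u : H) (ad v : H)
  adjoint_K0 : ∀ u v : smooth, inner ℂ (K0 u : H) (v : H) = inner ℂ (u : H) (K0 v : H)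
  adjoint_Km : ∀ u v : smooth, inner ℂ (Km u : H) (v : H) = inner ℂ (u : H) (Kp v : H)

/-- The skew-hermitian operator that represents an element of the real Jacobi algebra. -/
def DerivedRep.op {H : Type*} [NormedAddCommGroup H] [InnerProductSpace ℂ H] (R : DerivedRep H)
    (X : JacobiAlgebra) : Module.End ℂ R.smooth :=
  (Complex.I * (X.1 : ℂ)) • (1 : Module.End ℂ R.smooth)
    + (X.2.1 • R.ad - conj X.2.1 • R.a)
    + (2 * Complex.I * (X.2.2.1 : ℂ)) • R.K0
    + (X.2.2.2 • R.Kp - conj X.2.2.2 • R.Km)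

/-- A continuous unitary representation `π` of a connected Lie group whose Lie algebra is the Jacobi
algebra (the Jacobi group or one of its coverings), seen through its derived representation and
through the operators `expOp X = π (exp X)`: each `t ↦ π (exp (t X))` is a strongly continuous
one-parameter unitary group, with derivative `dπ(X) v` at `t = 0` on each smooth vector `v`. -/
structure UnitaryRep (H : Type*) [NormedAddCommGroup H] [InnerProductSpace ℂ H]
    extends DerivedRep H where
  /-- the unitary operator `π (exp X)` -/
  expOp : JacobiAlgebra → (H ≃ₗᵢ[ℂ] H)
  expOp_add : ∀ (X : JacobiAlgebra) (s t : ℝ),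
    expOp ((s + t) • X) = expOp (s • X) * expOp (t • X)
  expOp_continuous : ∀ (X : JacobiAlgebra) (v : H), Continuous fun t : ℝ => expOp (t • X) v
  expOp_deriv : ∀ (X : JacobiAlgebra) (v : smooth),
    HasDerivAt (fun t : ℝ => expOp (t • X) (v : H)) (toDerivedRep.op X v : H) 0

/-- `e0` is a normalized extremal (lowest weight) vector of weight `k`:
`a e0 = 0`, `K₋ e0 = 0`, `K₀ e0 = k e0`. -/
structure DerivedRep.IsExtremal {H : Type*} [NormedAddCommGroup H] [InnerProductSpace ℂ H]
    (R : DerivedRep H) (k : ℝ) (e0 : R.smooth) : Prop where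
  a_eq : R.a e0 = 0
  Km_eq : R.Km e0 = 0
  K0_eq : R.K0 e0 = (k : ℂ) • e0
  norm_eq : ‖(e0 : H)‖ = 1

section Vectors

variable {H : Type*} [NormedAddCommGroup H] [InnerProductSpace ℂ H]

/-- The displacement operator `D_μ(α) = exp (√μ (α a† - ᾱ a))`. -/
def UnitaryRep.displacement (π : UnitaryRep H) (μ : ℝ) (α : ℂ) : H ≃ₗᵢ[ℂ] H :=
  π.expOp (0, (Real.sqrt μ : ℂ) * α, 0, 0)

/-- The operator `exp (ζ K₊ - ζ̄ K₋)`. -/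
def UnitaryRep.squeezeExp (π : UnitaryRep H) (ζ : ℂ) : H ≃ₗᵢ[ℂ] H :=
  π.expOp (0, 0, 0, ζ)

/-- The point `w = (ζ / |ζ|) tanh |ζ|` of the unit disk (`w = 0` for `ζ = 0`). -/
def diskPoint (ζ : ℂ) : ℂ := ζ / (‖ζ‖ : ℂ) * (Real.tanh ‖ζ‖ : ℂ)

/-- The parameter `ζ = (w / |w|) artanh |w|` (`ζ = 0` for `w = 0`). -/
def diskParam (w : ℂ) : ℂ := w / (‖w‖ : ℂ) * (Real.artanh ‖w‖ : ℂ)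

/-- The operator `S(w) = exp (ζ K₊ - ζ̄ K₋)`, where `|w| < 1` and `w = (ζ / |ζ|) tanh |ζ|`. -/
def UnitaryRep.squeeze (π : UnitaryRep H) (w : ℂ) : H ≃ₗᵢ[ℂ] H :=
  π.squeezeExp (diskParam w)

/-- The normalized coherent state vector `D_μ(η) S(w) e0`. -/
def UnitaryRep.normalizedVec (π : UnitaryRep H) (μ : ℝ) (e0 : π.smooth) (η w : ℂ) : H :=
  π.displacement μ η (π.squeeze w (e0 : H))

/-- The `n`-th term `(√μ z a† + w K₊)ⁿ e0 / n!` of the exponential series of `e_{z,w}`. -/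
def DerivedRep.perelomovTerm (R : DerivedRep H) (μ : ℝ) (e0 : R.smooth) (z w : ℂ) (n : ℕ) : H :=
  ((n.factorial : ℂ)⁻¹) •
    (((((Real.sqrt μ : ℂ) * z) • R.ad + w • R.Kp) ^ n) e0 : H)

/-- Perelomov's coherent state vector `e_{z,w} = exp (√μ z a† + w K₊) e0`. -/
def DerivedRep.perelomovVec (R : DerivedRep H) (μ : ℝ) (e0 : R.smooth) (z w : ℂ) : H :=
  ∑' n : ℕ, R.perelomovTerm μ e0 z w n

/-- The normalization `ẽ_{z,w} = (e_{z,w}, e_{z,w})^{-1/2} e_{z,w}`. -/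
def DerivedRep.perelomovUnit (R : DerivedRep H) (μ : ℝ) (e0 : R.smooth) (z w : ℂ) : H :=
  ((‖R.perelomovVec μ e0 z w‖⁻¹ : ℝ) : ℂ) • R.perelomovVec μ e0 z w

end Vectors

/-- The Siegel-Jacobi disk `ℂ × {|w| < 1}`. -/
def disk : Set (ℂ × ℂ) := {p | ‖p.2‖ < 1}

/-- The change of variables `(η, w) ↦ (η - w η̄, w)`. -/
def FC (p : ℂ × ℂ) : ℂ × ℂ := (p.1 - p.2 * conj p.1, p.2)

/-- The change of variables `(z, w) ↦ ((z + z̄ w) / (1 - w w̄), w)`. -/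
def FCinv (p : ℂ × ℂ) : ℂ × ℂ := ((p.1 + conj p.1 * p.2) / (1 - p.2 * conj p.2), p.2)

/-- `diskParam w` is a parameter of the point `w` of the unit disk. -/
theorem diskPoint_diskParam {w : ℂ} (hw : ‖w‖ < 1) : diskPoint (diskParam w) = w := by
  rcases eq_or_ne w 0 with rfl | h0
  · simp [diskPoint, diskParam]
  have hn : 0 < ‖w‖ := norm_pos_iff.mpr h0
  have hpos : 0 < Real.artanh ‖w‖ := Real.artanh_pos ⟨hn, hw⟩
  have hnorm : ‖diskParam w‖ = Real.artanh ‖w‖ := by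
    simp [diskParam, abs_of_pos hpos, hn.ne']
  have h1 : (‖w‖ : ℂ) ≠ 0 := by exact_mod_cast hn.ne'
  have h2 : (Real.artanh ‖w‖ : ℂ) ≠ 0 := by exact_mod_cast hpos.ne'
  rw [diskPoint, hnorm, Real.tanh_artanh ⟨by linarith, hw⟩, diskParam]
  field_simp

end SiegelJacobi

end

/-! Each of the unitaries D and S is exp X for a skew-hermitian X in the Jacobi algebra, so its
action on a vector is found by exhibiting a curve with u' = X u and the right endpoints. The
annihilators act on the exponential vectors by first-order rules: a e = (β + w a†) e for e = exp(β
a† + w K₊) e0, and K₋ e = (2kw + w² K₊) e when β = 0. Hence c(t) exp(w(t) K₊) e0 solves the equation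
for S once w' = ζ - ζ̄ w² and c' = -2k ζ̄ w c, giving w = (ζ/|ζ|) tanh(t|ζ|) and c = (1 - |w|²)^k.
For D the curve is exp(-t² μ η̄ z / 2) e_{tz,w} with z = η - w η̄. Applying D to the squeezed vector
gives the first formula; inverting `FC` gives the second.

The analytic difficulty is that e_{z,w} is only a limit of smooth vectors, so X need not be defined
on it. The curves are therefore replaced by partial sums, which satisfy u' = X u + d with d made of
boundary terms of the series. `UnitaryRep.expOp_eq_of_approx` shows that d → 0 uniformly is enough,
and `exists_summable_norm_expTerm_le` provides this from growth bounds on a†^j K₊^n e0.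

The phase relation needs no formula for the norm of e_{z,w}: both sides are unit vectors, so the
positive factor in the first formula must be the inverse norm. -/

noncomputable section
namespace SiegelJacobi

open Filter Topology Finset

/-! ### One-parameter unitary groups and approximate solutions -/

section

/-- The product rule for a strongly continuous family of linear isometries acting on a curve. -/
theorem hasDerivAt_isometry_apply {H : Type*} [NormedAddCommGroup H] [InnerProductSpace ℂ H]
    {V : ℝ → (H ≃ₗᵢ[ℂ] H)} (hV : ∀ v, Continuous fun t => V t v) {f : ℝ → H} {f' g : H} {t : ℝ}
    (hf : HasDerivAt f f' t) (hg : HasDerivAt (fun s => V s (f t)) g t) :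
    HasDerivAt (fun s => V s (f s)) (V t f' + g) t := by
  rw [hasDerivAt_iff_isLittleO] at *
  -- The remainder splits into V s applied to the remainder of f (isometry), (s - t)(V s f' - V t
  -- f') (strong continuity), and the remainder of V s (f t).
  have h1 : (fun s => V s (f s - f t - (s - t) • f')) =o[𝓝 t] fun s => s - t := by
    refine Asymptotics.IsLittleO.congr_left (f₁ := fun s => V s (f s - f t - (s - t) • f')) ?_
      fun _ => rfl
    rw [← Asymptotics.isLittleO_norm_left]
    simpa only [LinearIsometryEquiv.norm_map] using hf.norm_left
  have h2 : (fun s => (s - t) • (V s f' - V t f')) =o[𝓝 t] fun s => s - t := by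
    have : (fun s => V s f' - V t f') =o[𝓝 t] fun _ => (1 : ℝ) := by
      rw [Asymptotics.isLittleO_one_iff]
      have := ((hV f').tendsto t).sub_const (V t f')
      simpa using this
    simpa using (Asymptotics.isBigO_refl (fun s : ℝ => s - t) (𝓝 t)).smul_isLittleO this
  refine ((h1.add h2).add hg).congr_left fun s => ?_
  have h3 : V s ((s - t) • f') = (s - t) • V s f' := by
    rw [← Complex.coe_smul, map_smul, Complex.coe_smul]
  simp only [map_sub, h3, smul_sub, smul_add]
  abel

variable {H : Type*} [NormedAddCommGroup H] [InnerProductSpace ℂ H]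

theorem UnitaryRep.expOp_zero (π : UnitaryRep H) : π.expOp 0 = 1 := by
  have h := π.expOp_add 0 0 0
  simp only [smul_zero] at h
  exact left_eq_mul.mp h

/-- The derivative is given only at time 0; the group law exp(-sX) = exp(-tX) exp((t - s)X) carries
it to any t. -/
theorem UnitaryRep.hasDerivAt_expOp_neg (π : UnitaryRep H) (X : JacobiAlgebra) (v : π.smooth)
    (t : ℝ) : HasDerivAt (fun s : ℝ => π.expOp ((-s) • X) (v : H))
      (-(π.expOp ((-t) • X) (π.op X v : H))) t := by
  have h1 : HasDerivAt (fun s : ℝ => π.expOp ((t - s) • X) (v : H)) (-(π.op X v : H)) t := by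
    have h := π.expOp_deriv X v
    rw [← sub_self t] at h
    simpa [Function.comp_def] using h.scomp t ((hasDerivAt_const t t).sub (hasDerivAt_id t))
  have h2 := ((π.expOp ((-t) • X)).toContinuousLinearEquiv.toContinuousLinearMap.restrictScalars
    ℝ).hasFDerivAt.comp_hasDerivAt t h1
  have h3 : (fun s : ℝ => π.expOp ((-s) • X) (v : H)) =
      fun s => π.expOp ((-t) • X) (π.expOp ((t - s) • X) (v : H)) := by
    funext s
    rw [show (-s) • X = (-t + (t - s)) • X by congr 1; ring, π.expOp_add]
    rfl
  rw [h3]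
  simpa [Function.comp_def] using h2

/-- A unitary one-parameter group is determined by approximate solutions, with values in the smooth
vectors, of the differential equation `u' = X u`. -/
theorem UnitaryRep.expOp_eq_of_approx (π : UnitaryRep H) (X : JacobiAlgebra)
    (u d : ℕ → ℝ → π.smooth) (ε : ℕ → ℝ) {x0 x1 : H}
    (hu : ∀ N, ∀ t ∈ Set.Icc (0 : ℝ) 1,
      HasDerivAt (fun s => (u N s : H)) ((π.op X (u N t) + d N t : π.smooth) : H) t)
    (hd : ∀ N, ∀ t ∈ Set.Icc (0 : ℝ) 1, ‖d N t‖ ≤ ε N) (hε : Tendsto ε atTop (𝓝 0))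
    (h0 : Tendsto (fun N => (u N 0 : H)) atTop (𝓝 x0))
    (h1 : Tendsto (fun N => (u N 1 : H)) atTop (𝓝 x1)) : π.expOp X x0 = x1 := by
  have hz : π.expOp ((-(0 : ℝ)) • X) = 1 := by rw [neg_zero, zero_smul, π.expOp_zero]
  have hinv : π.expOp X * π.expOp ((-(1 : ℝ)) • X) = 1 := by
    have h := π.expOp_add X 1 (-1)
    rwa [add_neg_cancel, zero_smul, π.expOp_zero, one_smul, eq_comm] at h
  -- Variation of constants: exp(-tX) u(t) has derivative exp(-tX) d(t), because the two X u terms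
  -- cancel. The mean value inequality then bounds its increment by ε.
  have key : ∀ N, ‖(u N 1 : H) - π.expOp X (u N 0 : H)‖ ≤ ε N := by
    intro N
    have hder : ∀ t ∈ Set.Icc (0 : ℝ) 1,
        HasDerivAt (fun s : ℝ => π.expOp ((-s) • X) (u N s : H))
          (π.expOp ((-t) • X) (d N t : H)) t := by
      intro t ht
      have h := hasDerivAt_isometry_apply (V := fun s : ℝ => π.expOp ((-s) • X))
        (fun v => (π.expOp_continuous X v).comp continuous_neg) (hu N t ht)
        (π.hasDerivAt_expOp_neg X (u N t) t)
      convert h using 1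
      simp
    have h := norm_image_sub_le_of_norm_deriv_le_segment_01' (C := ε N)
      (fun t ht => (hder t ht).hasDerivWithinAt) (fun t ht => by
        rw [LinearIsometryEquiv.norm_map]
        exact hd N t ⟨ht.1, ht.2.le⟩)
    rw [hz, ← LinearIsometryEquiv.norm_map (π.expOp X), map_sub,
      show π.expOp X (π.expOp ((-(1 : ℝ)) • X) (u N 1 : H)) = u N 1 from
        DFunLike.congr_fun hinv _] at h
    exact h
  have hlim := (h1.sub (((π.expOp X).continuous.tendsto x0).comp h0)).norm
  have := le_of_tendsto_of_tendsto' hlim hε key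
  exact (sub_eq_zero.mp (norm_le_zero_iff.mp this)).symm

/-! ### Commutator identities and norm recursions -/

/-- Leibniz rule for a commutator that is central with respect to `P`. -/
theorem mul_pow_succ_of_commutator {A : Type*} [Ring A] {a P Q : A} (h : a * P - P * a = Q)
    (hQ : Commute Q P) (n : ℕ) : a * P ^ (n + 1) = P ^ (n + 1) * a + (n + 1) • (Q * P ^ n) := by
  have h' : a * P = P * a + Q := by rw [← h]; abel
  induction n with
  | zero => simp [h']
  | succ n ih =>
    have e : Q * P ^ n * P = Q * P ^ (n + 1) := by rw [mul_assoc, ← pow_succ]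
    have e2 : P ^ (n + 1) * Q = Q * P ^ (n + 1) := (hQ.pow_right _).eq.symm
    rw [pow_succ P (n + 1), ← mul_assoc, ih, add_mul, mul_assoc _ a, h', mul_add, smul_mul_assoc, e,
      e2, ← mul_assoc, ← pow_succ, add_smul (n + 1) 1, one_smul]
    abel

namespace DerivedRep

variable (R : DerivedRep H)

theorem commute_Kp_ad : Commute R.Kp R.ad := sub_eq_zero.mp R.comm_Kp_ad

/-- The generator `β a† + w K₊` of Perelomov's coherent states. -/
def raise (β w : ℂ) : Module.End ℂ R.smooth := β • R.ad + w • R.Kp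

theorem commute_ad_raise (β w : ℂ) : Commute R.ad (R.raise β w) :=
  ((Commute.refl _).smul_right β).add_right (R.commute_Kp_ad.symm.smul_right w)

theorem commute_Kp_raise (β w : ℂ) : Commute R.Kp (R.raise β w) :=
  (R.commute_Kp_ad.smul_right β).add_right ((Commute.refl _).smul_right w)

theorem a_raise (β w : ℂ) :
    R.a * R.raise β w - R.raise β w * R.a = β • (1 : Module.End ℂ R.smooth) + w • R.ad := by
  simp only [raise, mul_add, add_mul, mul_smul_comm, smul_mul_assoc,
    sub_eq_iff_eq_add.mp R.comm_a_ad, sub_eq_iff_eq_add.mp R.comm_a_Kp, smul_add]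
  abel

variable {R}
variable {k : ℝ} {e0 : R.smooth}

/-- The commutator β + w a† of a with the generator commutes with the generator, so the Leibniz rule
applies, and a annihilates e0. -/
theorem a_raise_pow (he : R.a e0 = 0) (β w : ℂ) (n : ℕ) :
    R.a ((R.raise β w ^ (n + 1)) e0) = (n + 1 : ℂ) • (β • (R.raise β w ^ n) e0 +
      w • R.ad ((R.raise β w ^ n) e0)) := by
  have h := congrArg (fun T : Module.End ℂ R.smooth => T e0) (mul_pow_succ_of_commutator
    (R.a_raise β w) (((Commute.one_left _).smul_left β).add_left
      ((R.commute_ad_raise β w).smul_left w)) n)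
  simp only [Module.End.mul_apply, LinearMap.add_apply, he, map_zero, zero_add,
    LinearMap.smul_apply, Module.End.one_apply] at h
  rw [h, ← Nat.cast_smul_eq_nsmul ℂ]
  push_cast
  rfl

theorem a_ad_pow (j : ℕ) (v : R.smooth) : R.a ((R.ad ^ (j + 1)) v) =
    (R.ad ^ (j + 1)) (R.a v) + (j + 1 : ℂ) • (R.ad ^ j) v := by
  have h := congrArg (fun T : Module.End ℂ R.smooth => T v) (mul_pow_succ_of_commutator
    R.comm_a_ad (Commute.one_left _) j)
  simp only [Module.End.mul_apply, LinearMap.add_apply, one_mul, LinearMap.smul_apply] at h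
  rw [h, ← Nat.cast_smul_eq_nsmul ℂ]
  push_cast
  rfl

theorem a_Kp_pow (he : R.a e0 = 0) (n : ℕ) : R.a ((R.Kp ^ (n + 1)) e0) =
    (n + 1 : ℂ) • R.ad ((R.Kp ^ n) e0) := by
  have h := a_raise_pow he 0 1 n
  simpa [raise] using h

theorem K0_Kp_pow (he : R.IsExtremal k e0) (n : ℕ) :
    R.K0 ((R.Kp ^ n) e0) = (k + n : ℂ) • (R.Kp ^ n) e0 := by
  induction n with
  | zero => simpa using he.K0_eq
  | succ n ih =>
    have h := congrArg (fun T : Module.End ℂ R.smooth => T ((R.Kp ^ n) e0)) R.comm_K0_Kp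
    simp only [LinearMap.sub_apply, Module.End.mul_apply] at h
    rw [pow_succ', Module.End.mul_apply, sub_eq_iff_eq_add.mp h, ih, map_smul]
    push_cast
    module

/-- Moving K₋ to the right past each K₊ leaves 2K₀, and the weights add up: the sum of 2(k + j) over
j ≤ n is (n + 1)(2k + n). -/
theorem Km_Kp_pow (he : R.IsExtremal k e0) (n : ℕ) : R.Km ((R.Kp ^ (n + 1)) e0) =
    ((n + 1) * (2 * k + n) : ℂ) • (R.Kp ^ n) e0 := by
  have h (v : R.smooth) : R.Km (R.Kp v) = R.Kp (R.Km v) + (2 : ℂ) • R.K0 v := by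
    have h := congrArg (fun T : Module.End ℂ R.smooth => T v) R.comm_Km_Kp
    simp only [LinearMap.sub_apply, Module.End.mul_apply, LinearMap.smul_apply] at h
    rw [sub_eq_iff_eq_add'.mp h]
  induction n with
  | zero =>
    simp only [zero_add, pow_one, pow_zero, Module.End.one_apply, h, he.Km_eq, he.K0_eq, map_zero,
      smul_smul, Nat.cast_zero, add_zero, one_mul]
  | succ n ih =>
    rw [pow_succ', Module.End.mul_apply, h, ih, K0_Kp_pow he, map_smul, pow_succ' R.Kp n,
      Module.End.mul_apply]
    push_cast
    module

/-- This is a a† = a† a + 1 tested on v. It turns growth bounds for a† into bounds for a, which acts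
on the vectors a†^j K₊^n e0 explicitly. -/
theorem norm_ad_sq (v : R.smooth) : ‖R.ad v‖ ^ 2 = ‖R.a v‖ ^ 2 + ‖v‖ ^ 2 := by
  have h := congrArg (fun T : Module.End ℂ R.smooth => T v) R.comm_a_ad
  simp only [LinearMap.sub_apply, Module.End.mul_apply, Module.End.one_apply] at h
  have e : inner ℂ (R.ad v : H) (R.ad v : H) =
      inner ℂ (R.a v : H) (R.a v : H) + inner ℂ (v : H) (v : H) := by
    rw [← R.adjoint_a, R.adjoint_a v (R.a v), sub_eq_iff_eq_add'.mp h, Submodule.coe_add,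
      inner_add_left, ← inner_conj_symm (R.ad (R.a v) : H), ← R.adjoint_a, inner_conj_symm,
      R.adjoint_a]
  simp only [inner_self_eq_norm_sq_to_K] at e
  exact_mod_cast e

theorem norm_Kp_pow_succ_sq (he : R.IsExtremal k e0) (n : ℕ) :
    ‖(R.Kp ^ (n + 1)) e0‖ ^ 2 = (n + 1) * (2 * k + n) * ‖(R.Kp ^ n) e0‖ ^ 2 := by
  have e : inner ℂ ((R.Kp ^ (n + 1)) e0 : H) ((R.Kp ^ (n + 1)) e0 : H) =
      ((n + 1) * (2 * k + n) : ℂ) * inner ℂ ((R.Kp ^ n) e0 : H) ((R.Kp ^ n) e0 : H) := by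
    nth_rewrite 2 [pow_succ']
    rw [Module.End.mul_apply, ← R.adjoint_Km, Km_Kp_pow he, Submodule.coe_smul, inner_smul_left]
    simp [Complex.conj_ofNat]
  simp only [inner_self_eq_norm_sq_to_K] at e
  apply Complex.ofReal_injective
  push_cast
  exact e

end DerivedRep

end

/-! ### Growth bounds and uniform convergence of the exponential series -/

section

theorem summable_sqrt_factorial_mul_pow_div (x : ℝ) (i : ℕ) :
    Summable fun j : ℕ => √((j + i).factorial : ℝ) * x ^ j / (j.factorial : ℝ) := by
  refine Summable.of_norm_bounded (g := fun j : ℕ => (1 / 4 : ℝ) ^ j +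
    2 ^ i * i.factorial * ((8 * x ^ 2) ^ j / (j.factorial : ℝ)))
    ((summable_geometric_of_lt_one (by norm_num) (by norm_num)).add
      ((Real.summable_pow_div_factorial _).mul_left _)) fun j => ?_
  have hj : (0 : ℝ) < j.factorial := by exact_mod_cast j.factorial_pos
  have h1 : ((j + i).factorial : ℝ) ≤ 2 ^ (j + i) * j.factorial * i.factorial := by
    have h := Nat.add_choose_mul_factorial_mul_factorial j i
    have h2 := Nat.choose_le_two_pow (j + i) i
    rw [← h]
    exact_mod_cast Nat.mul_le_mul_right _ (Nat.mul_le_mul_right _ h2)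
  set s := √((j + i).factorial : ℝ)
  have hs : s ^ 2 = ((j + i).factorial : ℝ) := Real.sq_sqrt (by positivity)
  have hs0 : 0 ≤ s := Real.sqrt_nonneg _
  rw [Real.norm_eq_abs]
  -- A factor 2^(-j) is split off so that yz ≤ y² + z² yields a geometric series plus an exponential
  -- one. The 8 is 4 from squaring 2 times 2 from the bound of the binomial coefficient by 2^(j+i).
  have h3 : |s * x ^ j / (j.factorial : ℝ)| = (1 / 2) ^ j * ((2 * |x|) ^ j * s / j.factorial) := by
    rw [abs_div, abs_mul, abs_of_nonneg hs0, abs_of_pos hj, abs_pow, mul_pow, one_div, inv_pow]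
    field_simp
  rw [h3]
  have h4 : ((2 * |x|) ^ j * s / j.factorial) ^ 2 ≤
      2 ^ i * i.factorial * ((8 * x ^ 2) ^ j / (j.factorial : ℝ)) := by
    rw [div_pow, mul_pow, hs, ← pow_mul, mul_comm j 2, pow_mul, mul_pow, sq_abs, div_le_iff₀
      (by positivity)]
    calc (2 ^ 2 * x ^ 2) ^ j * ((j + i).factorial : ℝ)
        ≤ (2 ^ 2 * x ^ 2) ^ j * (2 ^ (j + i) * j.factorial * i.factorial) := by gcongr
      _ = 2 ^ i * i.factorial * (((2 ^ 2 * x ^ 2) ^ j * 2 ^ j) / j.factorial) *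
          (j.factorial : ℝ) ^ 2 := by
        field_simp
        ring
      _ = _ := by
        rw [← mul_pow]
        ring_nf
  have h5 : ((1 / 2 : ℝ) ^ j) ^ 2 = (1 / 4) ^ j := by
    rw [← pow_mul, mul_comm, pow_mul]
    norm_num
  rw [← h5]
  nlinarith [sq_nonneg ((1 / 2 : ℝ) ^ j - (2 * |x|) ^ j * s / j.factorial),
    sq_nonneg ((1 / 2 : ℝ) ^ j), sq_nonneg ((2 * |x|) ^ j * s / j.factorial)]

theorem summable_factorial_ratio_mul_geometric {q : ℝ} (hq0 : 0 ≤ q) (hq : q < 1) (l : ℕ) :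
    Summable fun n : ℕ => ((n + l).factorial : ℝ) / n.factorial * q ^ n := by
  have h := summable_descFactorial_mul_geometric_of_norm_lt_one l (r := q)
    (by rwa [Real.norm_of_nonneg hq0])
  refine h.congr fun n => ?_
  have h2 := Nat.factorial_mul_descFactorial (n := n + l) (k := l) (by omega)
  rw [Nat.add_sub_cancel] at h2
  rw [← h2]
  push_cast
  rw [mul_div_cancel_left₀]
  exact_mod_cast n.factorial_ne_zero

namespace DerivedRep

variable {H : Type*} [NormedAddCommGroup H] [InnerProductSpace ℂ H] {R : DerivedRep H}
variable {k : ℝ} {e0 : R.smooth}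

/-- The squares of ‖K₊^n e0‖ ρ^n / n! have successive ratio ρ² (2k + n)/(n + 1), which tends to ρ² <
1, so they are summable and in particular bounded. -/
theorem exists_norm_Kp_pow_le (hk : 0 < k) (he : R.IsExtremal k e0) {ρ : ℝ} (h0 : 0 < ρ)
    (h1 : ρ < 1) : ∃ C : ℝ, 0 ≤ C ∧ ∀ n, ‖(R.Kp ^ n) e0‖ * ρ ^ n ≤ C * n.factorial := by
  set g : ℕ → ℝ := fun n => ‖(R.Kp ^ n) e0‖ * ρ ^ n / n.factorial with hg
  have hfac (n : ℕ) : (0 : ℝ) < n.factorial := by exact_mod_cast n.factorial_pos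
  have hrec : ∀ n, (g (n + 1)) ^ 2 = (2 * k + n) / (n + 1) * ρ ^ 2 * (g n) ^ 2 := by
    intro n
    have := hfac n
    simp only [hg, Nat.factorial_succ, div_pow, mul_pow, norm_Kp_pow_succ_sq he]
    push_cast
    field_simp
    ring
  have hsum : Summable fun n => (g n) ^ 2 := by
    refine summable_of_ratio_norm_eventually_le h1 ?_
    -- From this index on the ratio is at most ρ, since (2k + n)ρ ≤ n + 1.
    obtain ⟨m, hm⟩ := exists_nat_gt (2 * k / (1 - ρ))
    filter_upwards [eventually_ge_atTop m] with n hn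
    rw [Real.norm_of_nonneg (sq_nonneg _), Real.norm_of_nonneg (sq_nonneg _), hrec]
    gcongr
    rw [div_lt_iff₀ (by linarith)] at hm
    have hn' : (m : ℝ) ≤ n := by exact_mod_cast hn
    rw [div_mul_eq_mul_div, div_le_iff₀ (by positivity)]
    nlinarith [mul_le_mul_of_nonneg_right hn' (sub_nonneg.mpr h1.le),
      mul_pos h0 (sub_pos.mpr h1)]
  obtain ⟨D, hD⟩ := hsum.tendsto_atTop_zero.bddAbove_range
  have hD' : ∀ n, (g n) ^ 2 ≤ D := fun n => hD ⟨n, rfl⟩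
  have hD0 : 0 ≤ D := (sq_nonneg _).trans (hD' 0)
  refine ⟨D + 1, by linarith, fun n => ?_⟩
  rw [← div_le_iff₀ (hfac n)]
  change g n ≤ _
  nlinarith [hD' n, sq_nonneg (g n - 1)]

theorem norm_a_ad_pow_Kp_pow_le (he : R.a e0 = 0) (j n : ℕ) :
    ‖R.a ((R.ad ^ j) ((R.Kp ^ n) e0))‖ ≤
      j * ‖(R.ad ^ (j - 1)) ((R.Kp ^ n) e0)‖ + n * ‖(R.ad ^ (j + 1)) ((R.Kp ^ (n - 1)) e0)‖ := by
  have h1 : R.a ((R.Kp ^ n) e0) = (n : ℂ) • R.ad ((R.Kp ^ (n - 1)) e0) := by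
    cases n with
    | zero => simpa using he
    | succ n => simpa using a_Kp_pow he n
  have h2 : R.a ((R.ad ^ j) ((R.Kp ^ n) e0)) = (R.ad ^ j) (R.a ((R.Kp ^ n) e0)) +
      (j : ℂ) • (R.ad ^ (j - 1)) ((R.Kp ^ n) e0) := by
    cases j with
    | zero => simp
    | succ j => simpa using a_ad_pow j ((R.Kp ^ n) e0)
  rw [h2, h1, map_smul, ← Module.End.mul_apply, ← pow_succ, add_comm]
  refine (norm_add_le _ _).trans ?_
  simp [norm_smul]

/-- Applying a to a†^j K₊^n e0 gives a term with j - 1 and a term with the pair (j + 1, n - 1). The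
latter has as many creation operators as the vector to be bounded, so the induction is on n, with an
inner one on j; it closes because lowering n gains the factor ρ < 1. -/
theorem exists_norm_ad_pow_Kp_pow_le (hk : 0 < k) (he : R.IsExtremal k e0) {ρ : ℝ} (h0 : 0 < ρ)
    (h1 : ρ < 1) : ∃ C A : ℝ, 0 ≤ C ∧ 0 ≤ A ∧ ∀ n j,
      ‖(R.ad ^ j) ((R.Kp ^ n) e0)‖ * ρ ^ n ≤ C * n.factorial * (A ^ j * √(j.factorial : ℝ)) := by
  obtain ⟨C, hC, hbase⟩ := exists_norm_Kp_pow_le hk he h0 h1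
  -- With this choice ρA = A - 4, so the inductive inequality (1 + ρA)² + 1 ≤ A² becomes (A - 3)² +
  -- 1 ≤ A², true for A ≥ 4.
  obtain ⟨A, hA⟩ : ∃ A : ℝ, (1 - ρ) * A = 4 := ⟨4 / (1 - ρ), by
    rw [mul_div_cancel₀]
    linarith⟩
  have hA4 : 4 ≤ A := by nlinarith
  have hs (j : ℕ) : √((j + 1).factorial : ℝ) = √(j + 1 : ℝ) * √(j.factorial : ℝ) := by
    rw [Nat.factorial_succ, ← Real.sqrt_mul (by positivity)]
    push_cast
    rfl
  have hstep : ∀ n : ℕ, (∀ j, n * ‖(R.ad ^ (j + 1)) ((R.Kp ^ (n - 1)) e0)‖ * ρ ^ n ≤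
      ρ * (C * n.factorial * (A ^ (j + 1) * √((j + 1).factorial : ℝ)))) → ∀ j,
      ‖(R.ad ^ j) ((R.Kp ^ n) e0)‖ * ρ ^ n ≤
        C * n.factorial * (A ^ j * √(j.factorial : ℝ)) := by
    intro n hlow j
    induction j using Nat.strong_induction_on with
    | _ j ih =>
    cases j with
    | zero => simpa using hbase n
    | succ j =>
      set F := C * n.factorial * (A ^ j * √(j.factorial : ℝ)) with hF
      set q := √(j + 1 : ℝ) with hq
      have hF0 : 0 ≤ F := by positivity
      have hq2 : q ^ 2 = j + 1 := Real.sq_sqrt (by positivity)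
      have hq0 : 0 ≤ q := Real.sqrt_nonneg _
      have hp : ‖(R.ad ^ j) ((R.Kp ^ n) e0)‖ * ρ ^ n ≤ F := ih j (by omega)
      have hx : j * ‖(R.ad ^ (j - 1)) ((R.Kp ^ n) e0)‖ * ρ ^ n ≤ F * q := by
        cases j with
        | zero => simpa using by positivity
        | succ i =>
          have h := ih i (by omega)
          have hi : (√(i + 1 : ℝ)) ^ 2 = i + 1 := Real.sq_sqrt (by positivity)
          have hiq : √(i + 1 : ℝ) ≤ q := Real.sqrt_le_sqrt (by push_cast; linarith)
          have hA1 : 1 ≤ A := by linarith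
          calc ((i + 1 : ℕ) : ℝ) * ‖(R.ad ^ (i + 1 - 1)) ((R.Kp ^ n) e0)‖ * ρ ^ n
              = √(i + 1 : ℝ) ^ 2 * (‖(R.ad ^ i) ((R.Kp ^ n) e0)‖ * ρ ^ n) := by
                rw [hi, Nat.add_sub_cancel]
                push_cast
                ring
            _ ≤ √(i + 1 : ℝ) ^ 2 * (C * n.factorial * (A ^ i * √(i.factorial : ℝ))) := by gcongr
            _ = (C * n.factorial * (A ^ i * 1 * (√(i + 1 : ℝ) * √(i.factorial : ℝ)))) *
                  √(i + 1 : ℝ) := by ring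
            _ ≤ (C * n.factorial * (A ^ i * A * (√(i + 1 : ℝ) * √(i.factorial : ℝ)))) * q := by
                gcongr
            _ = F * q := by rw [hF, hs, pow_succ]
      have hy : n * ‖(R.ad ^ (j + 1)) ((R.Kp ^ (n - 1)) e0)‖ * ρ ^ n ≤ ρ * A * (F * q) := by
        refine (hlow j).trans_eq ?_
        rw [hF, hs, pow_succ]
        ring
      have ha : ‖R.a ((R.ad ^ j) ((R.Kp ^ n) e0))‖ * ρ ^ n ≤ (1 + ρ * A) * (F * q) := by
        refine (mul_le_mul_of_nonneg_right (norm_a_ad_pow_Kp_pow_le he.a_eq j n)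
          (by positivity)).trans ?_
        rw [add_mul]
        linarith
      have hT : (‖(R.ad ^ (j + 1)) ((R.Kp ^ n) e0)‖ * ρ ^ n) ^ 2 ≤ (A * (F * q)) ^ 2 := by
        rw [pow_succ' R.ad, Module.End.mul_apply, mul_pow, norm_ad_sq, add_mul, ← mul_pow, ← mul_pow]
        have e1 := pow_le_pow_left₀ (by positivity) ha 2
        have e2 := pow_le_pow_left₀ (by positivity) hp 2
        have e3 : F ^ 2 ≤ (F * q) ^ 2 := by
          rw [mul_pow F q, hq2]
          nlinarith [mul_nonneg (sq_nonneg F) (Nat.cast_nonneg (α := ℝ) j)]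
        have e4 : (1 + ρ * A) ^ 2 + 1 ≤ A ^ 2 := by
          have : ρ * A = A - 4 := by linarith
          rw [this]
          nlinarith
        nlinarith [mul_le_mul_of_nonneg_right e4 (sq_nonneg (F * q))]
      refine ((pow_le_pow_iff_left₀ (by positivity) (by positivity) two_ne_zero).mp hT).trans_eq ?_
      rw [hF, hs, pow_succ]
      ring
  refine ⟨C, A, hC, by linarith, fun n => ?_⟩
  induction n with
  | zero =>
    refine hstep 0 fun j => ?_
    -- For n = 0 the truncated exponent n - 1 is harmless, because its term carries the coefficient
    -- n.
    rw [Nat.cast_zero, zero_mul, zero_mul]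
    have : 0 ≤ A := by linarith
    positivity
  | succ n ih =>
    refine hstep (n + 1) fun j => ?_
    have h := mul_le_mul_of_nonneg_left (ih (j + 1)) (by positivity : 0 ≤ ((n : ℝ) + 1) * ρ)
    rw [Nat.add_sub_cancel, Nat.factorial_succ n]
    push_cast
    calc _ = ((n : ℝ) + 1) * ρ * (‖(R.ad ^ (j + 1)) ((R.Kp ^ n) e0)‖ * ρ ^ n) := by ring
      _ ≤ _ := h
      _ = _ := by ring

/-- The `N`-th term of the exponential series of `exp (β a† + w K₊) e0`. -/
def expTerm (R : DerivedRep H) (β w : ℂ) (e0 : R.smooth) (N : ℕ) : R.smooth :=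
  ((N.factorial : ℂ)⁻¹) • (R.raise β w ^ N) e0

theorem expTerm_eq_sum (β w : ℂ) (N : ℕ) : R.expTerm β w e0 N =
    ∑ m ∈ antidiagonal N, (β ^ m.1 / m.1.factorial * (w ^ m.2 / m.2.factorial)) •
      (R.ad ^ m.1) ((R.Kp ^ m.2) e0) := by
  have hc : Commute (β • R.ad) (w • R.Kp) := (R.commute_Kp_ad.symm.smul_left β).smul_right w
  rw [expTerm, raise, hc.add_pow', LinearMap.sum_apply, smul_sum]
  refine sum_congr rfl fun m hm => ?_
  rw [HasAntidiagonal.mem_antidiagonal] at hm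
  have h1 : ((m.1.factorial : ℕ) : ℂ) ≠ 0 := by exact_mod_cast m.1.factorial_ne_zero
  have h2 : ((m.2.factorial : ℕ) : ℂ) ≠ 0 := by exact_mod_cast m.2.factorial_ne_zero
  have h3 : ((N.choose m.1 : ℕ) : ℂ) ≠ 0 := by
    exact_mod_cast (Nat.choose_pos (by omega)).ne'
  have h4 : (N.factorial : ℂ) = N.choose m.1 * m.1.factorial * m.2.factorial := by
    have := Nat.choose_mul_factorial_mul_factorial (show m.1 ≤ N by omega)
    rw [show N - m.1 = m.2 by omega] at this
    exact_mod_cast this.symm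
  rw [← Nat.cast_smul_eq_nsmul ℂ, LinearMap.smul_apply, smul_pow, smul_pow, smul_mul_smul_comm,
    LinearMap.smul_apply, smul_smul, smul_smul, Module.End.mul_apply, h4]
  congr 1
  field_simp

/-- With r < ρ < 1, the growth bound factors into a function of the power of a† and one of the power
of K₊, so the majorant is a Cauchy product of two summable series. The operators a†^i K₊^l are
included because the defects contain a† and K₊ applied to terms of the series. -/
theorem exists_summable_norm_expTerm_le (hk : 0 < k) (he : R.IsExtremal k e0) {b r : ℝ}
    (hb : 0 ≤ b) (hr : 0 ≤ r) (hr1 : r < 1) (i l : ℕ) :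
    ∃ M : ℕ → ℝ, Summable M ∧ ∀ β w : ℂ, ‖β‖ ≤ b → ‖w‖ ≤ r → ∀ N,
      ‖(R.ad ^ i) ((R.Kp ^ l) (R.expTerm β w e0 N))‖ ≤ M N := by
  obtain ⟨ρ, hrρ, hρ1⟩ := exists_between hr1
  have hρ0 : 0 < ρ := hr.trans_lt hrρ
  obtain ⟨C, A, hC, hA, hbd⟩ := exists_norm_ad_pow_Kp_pow_le hk he hρ0 hρ1
  set f : ℕ → ℝ := fun j => √((j + i).factorial : ℝ) * (A * b) ^ j / (j.factorial : ℝ) with hf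
  set h : ℕ → ℝ := fun n => ((n + l).factorial : ℝ) / n.factorial * (r / ρ) ^ n with hh
  have hsf : Summable fun j => ‖f j‖ := (summable_sqrt_factorial_mul_pow_div (A * b) i).norm
  have hsh : Summable fun n => ‖h n‖ :=
    (summable_factorial_ratio_mul_geometric (by positivity) ((div_lt_one hρ0).mpr hrρ) l).norm
  have hs := (summable_norm_sum_mul_antidiagonal_of_summable_norm hsf hsh).of_norm
  refine ⟨_, hs.mul_left (C * A ^ i / ρ ^ l), fun β w hβ hw N => ?_⟩
  rw [expTerm_eq_sum, map_sum, map_sum, mul_sum]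
  refine (norm_sum_le _ _).trans (sum_le_sum fun m _ => ?_)
  have e : (R.ad ^ i) ((R.Kp ^ l) ((R.ad ^ m.1) ((R.Kp ^ m.2) e0))) =
      (R.ad ^ (m.1 + i)) ((R.Kp ^ (m.2 + l)) e0) := by
    have hc : R.Kp ^ l * R.ad ^ m.1 = R.ad ^ m.1 * R.Kp ^ l := (R.commute_Kp_ad.pow_pow l m.1).eq
    rw [← Module.End.mul_apply (R.Kp ^ l), hc, Module.End.mul_apply, ← Module.End.mul_apply
      (R.ad ^ i), ← Module.End.mul_apply (R.Kp ^ l), ← pow_add, ← pow_add, add_comm i,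
      add_comm l]
  rw [map_smul, map_smul, norm_smul, e]
  have hb1 := hbd (m.2 + l) (m.1 + i)
  rw [← le_div_iff₀ (by positivity)] at hb1
  calc _ ≤ ‖β‖ ^ m.1 / m.1.factorial * (‖w‖ ^ m.2 / m.2.factorial) *
        (C * (m.2 + l).factorial * (A ^ (m.1 + i) * √((m.1 + i).factorial : ℝ)) /
          ρ ^ (m.2 + l)) := by
        rw [norm_mul, norm_div, norm_div, norm_pow, norm_pow, Complex.norm_natCast,
          Complex.norm_natCast]
        gcongr
    _ ≤ b ^ m.1 / m.1.factorial * (r ^ m.2 / m.2.factorial) *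
        (C * (m.2 + l).factorial * (A ^ (m.1 + i) * √((m.1 + i).factorial : ℝ)) /
          ρ ^ (m.2 + l)) := by gcongr
    _ = _ := by
        simp only [hf, hh, div_pow, mul_pow, pow_add]
        field_simp

end DerivedRep

end

/-! ### Calculus and annihilation rules for the partial sums -/

section

namespace DerivedRep

variable {H : Type*} [NormedAddCommGroup H] [InnerProductSpace ℂ H] {R : DerivedRep H}
variable {k : ℝ} {e0 : R.smooth}

theorem commute_raise_raise (β w β' w' : ℂ) : Commute (R.raise β w) (R.raise β' w') :=
  ((R.commute_ad_raise β' w').smul_left β).add_left ((R.commute_Kp_raise β' w').smul_left w)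

/-- The induction absorbs the leftmost a† or K₊ into T, so only scalar functions times already
treated curves are differentiated. Generators with different parameters commute, so the usual power
rule results. -/
theorem hasDerivAt_raise_pow {β w : ℝ → ℂ} {β' w' : ℂ} {t : ℝ} (hβ : HasDerivAt β β' t)
    (hw : HasDerivAt w w' t) (n : ℕ) (T : Module.End ℂ R.smooth) :
    HasDerivAt (fun s => ((T ((R.raise (β s) (w s) ^ n) e0) : R.smooth) : H))
      ((n : ℂ) • T (R.raise β' w' ((R.raise (β t) (w t) ^ (n - 1)) e0)) : R.smooth) t := by
  induction n generalizing T with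
  | zero => simpa using hasDerivAt_const t ((T e0 : R.smooth) : H)
  | succ n ih =>
    have h := (hβ.smul (ih (T * R.ad))).add (hw.smul (ih (T * R.Kp)))
    refine (h.congr_deriv ?_).congr_of_eventuallyEq (Eventually.of_forall fun s => ?_)
    · have hn : (n : ℂ) • R.raise (β t) (w t) (R.raise β' w' ((R.raise (β t) (w t) ^ (n - 1)) e0)) =
          (n : ℂ) • R.raise β' w' ((R.raise (β t) (w t) ^ n) e0) := by
        cases n with
        | zero => simp
        | succ n =>
          rw [← Module.End.mul_apply, (commute_raise_raise _ _ _ _).eq, Module.End.mul_apply,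
            Nat.add_sub_cancel, ← Module.End.mul_apply (R.raise (β t) (w t)), ← pow_succ']
      simp only [← Submodule.coe_smul, ← Submodule.coe_add]
      congr 1
      rw [Nat.add_sub_cancel, Nat.cast_succ, add_smul, one_smul, ← map_smul T (n : ℂ), ← hn,
        map_smul]
      simp only [Module.End.mul_apply, raise, LinearMap.add_apply, LinearMap.smul_apply, map_add,
        map_smul, smul_add]
      module
    · simp only [Pi.add_apply, Pi.smul_apply', ← Submodule.coe_smul, ← Submodule.coe_add]
      congr 1
      rw [pow_succ']
      simp [raise]

/-- Partial sums of the exponential series of `exp (β a† + w K₊) e0`. -/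
def expSum (R : DerivedRep H) (β w : ℂ) (e0 : R.smooth) (N : ℕ) : R.smooth :=
  ∑ n ∈ range N, R.expTerm β w e0 n

theorem expSum_succ (β w : ℂ) (N : ℕ) :
    R.expSum β w e0 (N + 1) = R.expSum β w e0 N + R.expTerm β w e0 N :=
  sum_range_succ _ _

theorem expTerm_zero (β w : ℂ) : R.expTerm β w e0 0 = e0 := by simp [expTerm]

theorem inv_factorial_succ_mul (n : ℕ) :
    (((n + 1).factorial : ℕ) : ℂ)⁻¹ * (n + 1) = ((n.factorial : ℕ) : ℂ)⁻¹ := by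
  have h1 : ((n.factorial : ℕ) : ℂ) ≠ 0 := by exact_mod_cast n.factorial_ne_zero
  have h2 : (n + 1 : ℂ) ≠ 0 := by exact_mod_cast n.succ_ne_zero
  rw [Nat.factorial_succ]
  push_cast
  field_simp

theorem hasDerivAt_expTerm_succ {β w : ℝ → ℂ} {β' w' : ℂ} {t : ℝ} (hβ : HasDerivAt β β' t)
    (hw : HasDerivAt w w' t) (n : ℕ) :
    HasDerivAt (fun s => (R.expTerm (β s) (w s) e0 (n + 1) : H))
      (R.raise β' w' (R.expTerm (β t) (w t) e0 n) : R.smooth) t := by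
  have h := (hasDerivAt_raise_pow (e0 := e0) hβ hw (n + 1) 1).const_smul
    (((n + 1).factorial : ℂ)⁻¹)
  refine h.congr_deriv ?_
  rw [← Submodule.coe_smul]
  congr 1
  rw [smul_smul, expTerm, map_smul]
  push_cast
  rw [inv_factorial_succ_mul]
  simp

/-- Differentiation drops one term from the partial sum; this mismatch of lengths is one source of
the defect in the differential equation. -/
theorem hasDerivAt_expSum_succ {β w : ℝ → ℂ} {β' w' : ℂ} {t : ℝ} (hβ : HasDerivAt β β' t)
    (hw : HasDerivAt w w' t) (N : ℕ) :
    HasDerivAt (fun s => (R.expSum (β s) (w s) e0 (N + 1) : H))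
      (R.raise β' w' (R.expSum (β t) (w t) e0 N) : R.smooth) t := by
  induction N with
  | zero => simpa [expSum, expTerm_zero] using hasDerivAt_const t (e0 : H)
  | succ N ih =>
    have h := ih.add (hasDerivAt_expTerm_succ (e0 := e0) hβ hw N)
    rw [expSum_succ, map_add, Submodule.coe_add]
    refine h.congr_of_eventuallyEq (Eventually.of_forall fun s => ?_)
    simp [expSum_succ _ _ (N + 1)]

theorem a_expTerm_succ (he : R.a e0 = 0) (β w : ℂ) (n : ℕ) : R.a (R.expTerm β w e0 (n + 1)) =
    β • R.expTerm β w e0 n + w • R.ad (R.expTerm β w e0 n) := by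
  rw [expTerm, map_smul, a_raise_pow he, smul_smul, inv_factorial_succ_mul, expTerm, map_smul]
  module

/-- Truncated form of a e = (β + w a†) e. -/
theorem a_expSum_succ (he : R.a e0 = 0) (β w : ℂ) (N : ℕ) : R.a (R.expSum β w e0 (N + 1)) =
    β • R.expSum β w e0 N + w • R.ad (R.expSum β w e0 N) := by
  induction N with
  | zero => simp [expSum, expTerm_zero, he]
  | succ N ih =>
    rw [expSum_succ _ _ (N + 1), map_add, ih, a_expTerm_succ he, expSum_succ, map_add]
    module

theorem expTerm_zero_left (w : ℂ) (n : ℕ) :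
    R.expTerm 0 w e0 n = (w ^ n / n.factorial) • (R.Kp ^ n) e0 := by
  rw [expTerm, raise, zero_smul, zero_add, smul_pow, LinearMap.smul_apply, smul_smul]
  congr 1
  ring

theorem Km_expTerm_one (he : R.IsExtremal k e0) (w : ℂ) :
    R.Km (R.expTerm 0 w e0 1) = (2 * k * w) • R.expTerm 0 w e0 0 := by
  have h := Km_Kp_pow he 0
  rw [expTerm_zero_left, map_smul, h, expTerm_zero]
  simp [smul_smul, mul_comm]

theorem Km_expTerm_add_two (he : R.IsExtremal k e0) (w : ℂ) (n : ℕ) :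
    R.Km (R.expTerm 0 w e0 (n + 2)) = (2 * k * w) • R.expTerm 0 w e0 (n + 1) +
      w ^ 2 • R.Kp (R.expTerm 0 w e0 n) := by
  simp only [expTerm_zero_left, map_smul]
  rw [Km_Kp_pow he, ← Module.End.mul_apply, ← pow_succ', smul_smul, smul_smul, smul_smul,
    ← add_smul]
  congr 1
  have h1 : ((n.factorial : ℕ) : ℂ) ≠ 0 := by exact_mod_cast n.factorial_ne_zero
  have h2 : (n + 1 : ℂ) ≠ 0 := by exact_mod_cast n.succ_ne_zero
  have h3 : (n + 1 + 1 : ℂ) ≠ 0 := by exact_mod_cast (n + 1).succ_ne_zero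
  rw [Nat.factorial_succ (n + 1), Nat.factorial_succ n]
  push_cast
  field_simp
  ring

/-- Truncated form of K₋ e = (2kw + w² K₊) e. The factor 2k + n + 1 in K₋ K₊^(n+2) e0 splits into 2k
and n + 1, which lowers the index by one and by two respectively. -/
theorem Km_expSum_add_two (he : R.IsExtremal k e0) (w : ℂ) (N : ℕ) :
    R.Km (R.expSum 0 w e0 (N + 2)) = (2 * k * w) • R.expSum 0 w e0 (N + 1) +
      w ^ 2 • R.Kp (R.expSum 0 w e0 N) := by
  induction N with
  | zero =>
    rw [expSum_succ, map_add, Km_expTerm_one he]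
    simp [expSum, expTerm_zero, he.Km_eq]
  | succ N ih =>
    rw [expSum_succ _ _ (N + 2), map_add, ih, Km_expTerm_add_two he, expSum_succ _ _ (N + 1),
      expSum_succ _ _ N, map_add]
    module

theorem perelomovTerm_eq (R : DerivedRep H) (μ : ℝ) (e0 : R.smooth) (z w : ℂ) (n : ℕ) :
    R.perelomovTerm μ e0 z w n = R.expTerm ((√μ : ℂ) * z) w e0 n := rfl

theorem summable_perelomovTerm [CompleteSpace H] (hk : 0 < k) (he : R.IsExtremal k e0) (μ : ℝ)
    (z : ℂ) {w : ℂ} (hw : ‖w‖ < 1) : Summable (R.perelomovTerm μ e0 z w) := by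
  obtain ⟨M, hM, hb⟩ := exists_summable_norm_expTerm_le hk he
    (norm_nonneg ((√μ : ℂ) * z)) (norm_nonneg w) hw 0 0
  refine Summable.of_norm_bounded hM fun n => ?_
  exact hb _ w le_rfl le_rfl n

theorem tendsto_expSum [CompleteSpace H] (hk : 0 < k) (he : R.IsExtremal k e0) (μ : ℝ)
    (z : ℂ) {w : ℂ} (hw : ‖w‖ < 1) :
    Tendsto (fun N => (R.expSum ((√μ : ℂ) * z) w e0 N : H)) atTop
      (𝓝 (R.perelomovVec μ e0 z w)) := by
  have h := (summable_perelomovTerm hk he μ z hw).hasSum.tendsto_sum_nat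
  refine h.congr fun N => ?_
  simp [expSum, perelomovTerm_eq]

end DerivedRep

theorem UnitaryRep.norm_normalizedVec {H : Type*} [NormedAddCommGroup H] [InnerProductSpace ℂ H]
    (π : UnitaryRep H) {k : ℝ} {e0 : π.smooth} (he : π.IsExtremal k e0) (μ : ℝ) (η w : ℂ) :
    ‖π.normalizedVec μ e0 η w‖ = 1 := by
  rw [normalizedVec, LinearIsometryEquiv.norm_map, LinearIsometryEquiv.norm_map, he.norm_eq]

/-! ### Action of the displacement and squeeze operators -/

open DerivedRep

variable {H : Type*} [NormedAddCommGroup H] [InnerProductSpace ℂ H] [CompleteSpace H]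
variable (π : UnitaryRep H) {k : ℝ} {e0 : π.smooth}

theorem UnitaryRep.displacement_perelomovVec (hk : 0 < k) (he : π.IsExtremal k e0) {μ : ℝ}
    (hμ : 0 < μ) (η : ℂ) {w : ℂ} (hw : ‖w‖ < 1) :
    π.displacement μ η (π.perelomovVec μ e0 0 w) =
      Complex.exp (-(1 / 2) * μ * conj η * (η - w * conj η)) •
        π.perelomovVec μ e0 (η - w * conj η) w := by
  set z := η - w * conj η with hz
  set s : ℂ := (√μ : ℂ) with hs
  have hss : s * s = μ := by
    rw [hs, ← Complex.ofReal_mul, Real.mul_self_sqrt hμ.le]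
  have hsc : conj s = s := Complex.conj_ofReal _
  obtain ⟨M, hM, hMb⟩ := exists_summable_norm_expTerm_le hk he
    (norm_nonneg (s * z)) (norm_nonneg w) hw 0 0
  obtain ⟨M', hM', hMb'⟩ := exists_summable_norm_expTerm_le hk he
    (norm_nonneg (s * z)) (norm_nonneg w) hw 1 0
  simp only [pow_zero, pow_one, Module.End.one_apply] at hMb hMb'
  set x : ℂ := -(1 / 2) * μ * conj η * z with hx
  set c : ℝ → ℂ := fun t => Complex.exp (t ^ 2 * x) with hc
  have hc' (t : ℝ) : HasDerivAt c (c t * (2 * t * x)) t := by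
    have h1 : HasDerivAt (fun t : ℝ => (t : ℂ) ^ 2 * x) (2 * t * x) t := by
      simpa using ((Complex.ofRealCLM.hasDerivAt (x := t)).pow 2).mul_const x
    exact h1.cexp
  have hβ (t : ℝ) : HasDerivAt (fun t : ℝ => s * (t * z)) (s * z) t := by
    simpa using ((Complex.ofRealCLM.hasDerivAt (x := t)).mul_const z).const_mul s
  have hnt {t : ℝ} (ht : t ∈ Set.Icc (0 : ℝ) 1) : ‖(t : ℂ)‖ ≤ 1 := by
    rw [Complex.norm_real, Real.norm_of_nonneg ht.1]
    exact ht.2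
  -- For the full series the equation holds because s z = s η - s η̄ w and 2 t x = -s η̄ (s t z).
  -- After truncation only the N-th term survives, bare and under a†.
  refine π.expOp_eq_of_approx (0, s * η, 0, 0)
    (fun N t => c t • π.expSum (s * (t * z)) w e0 (N + 1))
    (fun N t => c t • ((2 * t * x) • π.expTerm (s * (t * z)) w e0 N -
      (s * η) • π.ad (π.expTerm (s * (t * z)) w e0 N)))
    (fun N => Real.exp ‖x‖ * (2 * ‖x‖ * M N + ‖s * η‖ * M' N)) ?_ ?_ ?_ ?_ ?_
  · intro N t _
    have h := (hc' t).smul (hasDerivAt_expSum_succ (R := π.toDerivedRep) (e0 := e0) (hβ t)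
      (hasDerivAt_const t w) N)
    refine h.congr_deriv ?_
    rw [← Submodule.coe_smul, ← Submodule.coe_smul, ← Submodule.coe_add]
    congr 1
    have hop (v : π.smooth) : π.op (0, s * η, 0, 0) v =
        (s * η) • π.ad v - (s * conj η) • π.a v := by
      simp [DerivedRep.op, hsc]
    rw [hop, map_smul, map_smul, a_expSum_succ he.a_eq, expSum_succ]
    simp only [raise, zero_smul, add_zero, LinearMap.smul_apply, map_add]
    have e1 : s * z = s * η - s * conj η * w := by rw [hz]; ring
    have e2 : 2 * t * x = -(s * conj η * (s * (t * z))) := by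
      rw [hx, ← hss]
      ring
    rw [e2, e1]
    module
  · intro N t ht
    have hb : ‖s * (t * z)‖ ≤ ‖s * z‖ := by
      rw [mul_left_comm, norm_mul]
      exact mul_le_of_le_one_left (norm_nonneg _) (hnt ht)
    have hcb : ‖c t‖ ≤ Real.exp ‖x‖ := by
      refine (Complex.norm_exp_le_exp_norm _).trans (Real.exp_le_exp.mpr ?_)
      rw [norm_mul, norm_pow]
      exact mul_le_of_le_one_left (norm_nonneg _) (pow_le_one₀ (norm_nonneg _) (hnt ht))
    have hxb : ‖2 * (t : ℂ) * x‖ ≤ 2 * ‖x‖ := by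
      rw [norm_mul, norm_mul, Complex.norm_ofNat]
      have := mul_le_of_le_one_left (norm_nonneg x) (hnt ht)
      linarith
    rw [norm_smul]
    refine mul_le_mul hcb ((norm_sub_le _ _).trans ?_) (norm_nonneg _) (Real.exp_nonneg _)
    rw [norm_smul, norm_smul]
    gcongr
    · exact hMb _ w hb le_rfl N
    · exact hMb' _ w hb le_rfl N
  · simpa using ((hM.tendsto_atTop_zero.const_mul (2 * ‖x‖)).add
      (hM'.tendsto_atTop_zero.const_mul ‖s * η‖)).const_mul (Real.exp ‖x‖)
  · have h := (tendsto_expSum hk he μ 0 hw).comp (tendsto_add_atTop_nat 1)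
    simpa [hc, Function.comp_def] using h
  · have h := ((tendsto_expSum hk he μ z hw).comp (tendsto_add_atTop_nat 1)).const_smul (c 1)
    simpa [hc, Function.comp_def] using h

theorem hasDerivAt_tanh (x : ℝ) : HasDerivAt Real.tanh (1 - Real.tanh x ^ 2) x := by
  have h := (Real.hasDerivAt_sinh x).div (Real.hasDerivAt_cosh x) (Real.cosh_pos x).ne'
  have e : Real.tanh = fun y => Real.sinh y / Real.cosh y :=
    funext Real.tanh_eq_sinh_div_cosh
  rw [e]
  refine h.congr_deriv ?_
  have := (Real.cosh_pos x).ne'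
  field_simp

theorem monotone_tanh : Monotone Real.tanh :=
  monotone_of_deriv_nonneg (fun x => (hasDerivAt_tanh x).differentiableAt) fun x => by
    rw [(hasDerivAt_tanh x).deriv]
    linarith [Real.tanh_sq_lt_one x]

theorem norm_diskPoint (ζ : ℂ) : ‖diskPoint ζ‖ = Real.tanh ‖ζ‖ := by
  have h0 : 0 ≤ Real.tanh ‖ζ‖ := by
    simpa using monotone_tanh (norm_nonneg ζ)
  rcases eq_or_ne ζ 0 with rfl | h
  · simp [diskPoint]
  · have : ‖ζ‖ ≠ 0 := norm_ne_zero_iff.mpr h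
    rw [diskPoint, norm_mul, norm_div, Complex.norm_real, Complex.norm_real, norm_norm,
      div_self this, one_mul, Real.norm_of_nonneg h0]

theorem UnitaryRep.squeezeExp_extremal (hk : 0 < k) (he : π.IsExtremal k e0) (μ : ℝ) (ζ : ℂ) :
    π.squeezeExp ζ (e0 : H) = (((1 - ‖diskPoint ζ‖ ^ 2) ^ k : ℝ) : ℂ) •
      π.perelomovVec μ e0 0 (diskPoint ζ) := by
  set θ : ℂ := ζ / (‖ζ‖ : ℂ) with hθ
  have hθ1 : θ * ‖ζ‖ = ζ := by
    rcases eq_or_ne ζ 0 with rfl | h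
    · simp
    · rw [hθ, div_mul_cancel₀]
      exact_mod_cast norm_ne_zero_iff.mpr h
  have hθ2 : conj ζ * θ = ‖ζ‖ := by
    rcases eq_or_ne ζ 0 with rfl | h
    · simp
    · have h' : (‖ζ‖ : ℂ) ≠ 0 := by exact_mod_cast norm_ne_zero_iff.mpr h
      rw [hθ, mul_div_assoc', Complex.conj_mul', sq, mul_div_cancel_right₀ _ h']
  set τ : ℝ → ℝ := fun t => Real.tanh (t * ‖ζ‖) with hτ
  have hτ' (t : ℝ) : HasDerivAt τ (‖ζ‖ * (1 - τ t ^ 2)) t := by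
    have h := (hasDerivAt_tanh (t * ‖ζ‖)).comp t ((hasDerivAt_id t).mul_const ‖ζ‖)
    exact h.congr_deriv (by rw [one_mul, mul_comm])
  have hτ1 (t : ℝ) : 0 < 1 - τ t ^ 2 := by linarith [Real.tanh_sq_lt_one (t * ‖ζ‖)]
  set w : ℝ → ℂ := fun t => θ * τ t with hw
  -- The Riccati equation that matches the K₊ coefficients.
  have hw' (t : ℝ) : HasDerivAt w (ζ - conj ζ * w t ^ 2) t := by
    refine ((hτ' t).ofReal_comp.const_mul θ).congr_deriv ?_
    rw [hw]
    push_cast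
    linear_combination hθ1 + θ * (τ t : ℂ) ^ 2 * hθ2
  set c : ℝ → ℝ := fun t => (1 - τ t ^ 2) ^ k with hc
  -- This scalar equation cancels the 2kw coming from K₋.
  have hc' (t : ℝ) : HasDerivAt (fun t => (c t : ℂ)) (c t * (-(2 * k * (conj ζ * w t)))) t := by
    have h0 : HasDerivAt (fun t => 1 - τ t ^ 2) (-(2 * τ t * (‖ζ‖ * (1 - τ t ^ 2)))) t := by
      simpa using ((hτ' t).pow 2).const_sub 1
    refine (h0.rpow_const (p := k) (Or.inl (hτ1 t).ne')).ofReal_comp.congr_deriv ?_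
    have hcw : conj ζ * w t = ((‖ζ‖ * τ t : ℝ) : ℂ) := by
      rw [hw, ← mul_assoc, hθ2, Complex.ofReal_mul]
    rw [hcw, Real.rpow_sub_one (hτ1 t).ne']
    have := (hτ1 t).ne'
    norm_cast
    simp only [hc]
    field_simp
  have hθn : ‖θ‖ ≤ 1 := by
    rw [hθ, norm_div, Complex.norm_real, norm_norm]
    exact div_self_le_one _
  have hτ0 {t : ℝ} (ht : t ∈ Set.Icc (0 : ℝ) 1) : 0 ≤ τ t := by
    simpa using monotone_tanh (mul_nonneg ht.1 (norm_nonneg ζ))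
  set r : ℝ := Real.tanh ‖ζ‖ with hr
  have hr0 : 0 ≤ r := by simpa using monotone_tanh (norm_nonneg ζ)
  have hr1 : r < 1 := Real.tanh_lt_one _
  have hwr {t : ℝ} (ht : t ∈ Set.Icc (0 : ℝ) 1) : ‖w t‖ ≤ r := by
    rw [hw, norm_mul, Complex.norm_real, Real.norm_of_nonneg (hτ0 ht)]
    refine (mul_le_of_le_one_left (hτ0 ht) hθn).trans (monotone_tanh ?_)
    exact mul_le_of_le_one_left (norm_nonneg ζ) ht.2
  have hw1 : w 1 = diskPoint ζ := by simp [hw, hτ, hθ, diskPoint]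
  have hc1 : c 1 = (1 - ‖diskPoint ζ‖ ^ 2) ^ k := by simp [hc, hτ, norm_diskPoint]
  obtain ⟨M, hM, hMb⟩ := exists_summable_norm_expTerm_le hk he le_rfl hr0 hr1 0 0
  obtain ⟨M', hM', hMb'⟩ := exists_summable_norm_expTerm_le hk he le_rfl hr0 hr1 0 1
  simp only [pow_zero, pow_one, Module.End.one_apply] at hMb hMb'
  have hM1 := (hM.tendsto_atTop_zero).comp (tendsto_add_atTop_nat 1)
  have hM1' := (hM'.tendsto_atTop_zero).comp (tendsto_add_atTop_nat 1)
  -- Partial sums of length N + 2 are used because K₋ relates three consecutive lengths; the defect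
  -- involves the terms N and N + 1.
  refine π.expOp_eq_of_approx (0, 0, 0, ζ)
    (fun N t => (c t : ℂ) • π.expSum 0 (w t) e0 (N + 2))
    (fun N t => (c t : ℂ) • (-((2 * k * (conj ζ * w t)) • π.expTerm 0 (w t) e0 (N + 1)) -
      ζ • π.Kp (π.expTerm 0 (w t) e0 (N + 1)) -
      (conj ζ * w t ^ 2) • π.Kp (π.expTerm 0 (w t) e0 N)))
    (fun N => 1 * (2 * k * (‖ζ‖ * r) * M (N + 1) + ‖ζ‖ * M' (N + 1) + ‖ζ‖ * r ^ 2 * M' N))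
    ?_ ?_ ?_ ?_ ?_
  · intro N t _
    have h := (hc' t).smul (hasDerivAt_expSum_succ (R := π.toDerivedRep) (e0 := e0)
      (hasDerivAt_const t (0 : ℂ)) (hw' t) (N + 1))
    refine h.congr_deriv ?_
    rw [← Submodule.coe_smul, ← Submodule.coe_smul, ← Submodule.coe_add]
    congr 1
    have hop (v : π.smooth) : π.op (0, 0, 0, ζ) v = ζ • π.Kp v - conj ζ • π.Km v := by
      simp [DerivedRep.op]
    rw [hop, map_smul, map_smul, Km_expSum_add_two he, expSum_succ _ _ (N + 1)]
    simp only [raise, zero_smul, zero_add, LinearMap.smul_apply, map_add]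
    rw [expSum_succ _ _ N, map_add]
    module
  · intro N t ht
    have hwt := hwr ht
    have h0 : ‖(0 : ℂ)‖ ≤ 0 := norm_zero.le
    have hcb : ‖(c t : ℂ)‖ ≤ 1 := by
      rw [Complex.norm_real, Real.norm_of_nonneg (Real.rpow_nonneg (hτ1 t).le _)]
      exact Real.rpow_le_one (hτ1 t).le (by linarith [sq_nonneg (τ t)]) hk.le
    rw [norm_smul]
    refine mul_le_mul hcb ((norm_sub_le _ _).trans (add_le_add ((norm_sub_le _ _).trans
      (add_le_add ?_ ?_)) ?_)) (norm_nonneg _) zero_le_one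
    · rw [norm_neg, norm_smul, norm_mul, norm_mul, norm_mul, Complex.norm_ofNat,
        Complex.norm_real, Real.norm_of_nonneg hk.le, RCLike.norm_conj]
      gcongr
      exact hMb 0 _ h0 hwt _
    · rw [norm_smul]
      gcongr
      exact hMb' 0 _ h0 hwt _
    · rw [norm_smul, norm_mul, norm_pow, RCLike.norm_conj]
      gcongr
      exact hMb' 0 _ h0 hwt _
  · simpa [Function.comp_def] using (((hM1.const_mul (2 * k * (‖ζ‖ * r))).add
      (hM1'.const_mul ‖ζ‖)).add (hM'.tendsto_atTop_zero.const_mul (‖ζ‖ * r ^ 2))).const_mul 1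
  · have h (N : ℕ) : π.expSum 0 (0 : ℂ) e0 (N + 2) = e0 := by
      rw [expSum, sum_range_succ', sum_eq_zero fun n _ => by simp [expTerm_zero_left],
        expTerm_zero, zero_add]
    have hw0 : w 0 = 0 := by simp [hw, hτ]
    have hc0 : c 0 = 1 := by simp [hc, hτ]
    simp [hw0, hc0, h]
  · have hd : ‖diskPoint ζ‖ < 1 := by rwa [norm_diskPoint]
    have h := ((tendsto_expSum hk he μ 0 hd).comp (tendsto_add_atTop_nat 2)).const_smul (c 1 : ℂ)
    rw [hc1] at h
    simpa [Function.comp_def, hw1, hc1] using h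

theorem UnitaryRep.normalizedVec_eq (hk : 0 < k) (he : π.IsExtremal k e0) {μ : ℝ} (hμ : 0 < μ)
    (η : ℂ) {w : ℂ} (hw : ‖w‖ < 1) :
    π.normalizedVec μ e0 η w = ((((1 - ‖w‖ ^ 2) ^ k : ℝ) : ℂ) *
      Complex.exp (-(1 / 2) * μ * conj η * (η - w * conj η))) •
        π.perelomovVec μ e0 (η - w * conj η) w := by
  rw [normalizedVec, squeeze, π.squeezeExp_extremal hk he μ, diskPoint_diskParam hw, map_smul,
    π.displacement_perelomovVec hk he hμ η hw, smul_smul]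

/-! ### The change of variables on the Siegel-Jacobi disk -/

theorem one_sub_mul_conj_ne_zero {w : ℂ} (hw : ‖w‖ < 1) : 1 - w * conj w ≠ 0 := by
  rw [Complex.mul_conj']
  have : 0 < 1 - ‖w‖ ^ 2 := by nlinarith [norm_nonneg w]
  exact_mod_cast this.ne'

theorem FCinv_FC {p : ℂ × ℂ} (hp : p ∈ disk) : FCinv (FC p) = p := by
  have h := one_sub_mul_conj_ne_zero hp
  ext1
  · simp only [FC, FCinv, map_sub, map_mul, Complex.conj_conj]
    rw [div_eq_iff h]
    ring
  · rfl

theorem FC_FCinv {p : ℂ × ℂ} (hp : p ∈ disk) : FC (FCinv p) = p := by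
  have h := one_sub_mul_conj_ne_zero hp
  have h' : 1 - conj p.2 * p.2 ≠ 0 := by rwa [mul_comm]
  ext1
  · simp only [FC, FCinv, map_div₀, map_sub, map_add, map_mul, Complex.conj_conj, map_one]
    rw [mul_comm (conj p.2) p.2]
    field_simp
    ring
  · rfl

theorem contDiff_FC : ContDiff ℝ ∞ FC := by
  have hc : ContDiff ℝ ∞ (fun z : ℂ => conj z) := Complex.conjCLE.contDiff
  exact (contDiff_fst.sub (contDiff_snd.mul (hc.comp contDiff_fst))).prodMk contDiff_snd

theorem contDiffOn_FCinv : ContDiffOn ℝ ∞ FCinv disk := by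
  have hc : ContDiff ℝ ∞ (fun z : ℂ => conj z) := Complex.conjCLE.contDiff
  have h1 : ContDiff ℝ ∞ fun p : ℂ × ℂ => p.1 + conj p.1 * p.2 :=
    contDiff_fst.add ((hc.comp contDiff_fst).mul contDiff_snd)
  have h2 : ContDiff ℝ ∞ fun p : ℂ × ℂ => 1 - p.2 * conj p.2 :=
    contDiff_const.sub (contDiff_snd.mul (hc.comp contDiff_snd))
  have h3 := h1.contDiffOn.mul (h2.contDiffOn.inv (s := disk)
    fun p hp => one_sub_mul_conj_ne_zero hp)
  exact (h3.congr fun p _ => div_eq_mul_inv _ _).prodMk contDiff_snd.contDiffOn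

end

end SiegelJacobi

end

/-! ### Assembly and the phase relation -/

theorem lemma6 {H : Type*} [NormedAddCommGroup H] [InnerProductSpace ℂ H] [CompleteSpace H]
    (π : SiegelJacobi.UnitaryRep H) (μ k : ℝ) (hμ : 0 < μ) (hk : 0 < k)
    (e0 : π.smooth) (he0 : π.IsExtremal k e0) :
    -- the exponential series of the vectors `e_{z,w}` converges on the Siegel-Jacobi disk
    (∀ z w : ℂ, ‖w‖ < 1 → Summable (π.perelomovTerm μ e0 z w)) ∧
    -- normalized vectors through unnormalized ones
    (∀ η w z : ℂ, ‖w‖ < 1 → z = η - w * (starRingEnd ℂ) η →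
      π.normalizedVec μ e0 η w =
        ((((1 - ‖w‖ ^ 2) ^ k : ℝ) : ℂ) *
          Complex.exp (-(1 / 2) * μ * (starRingEnd ℂ) η * z)) • π.perelomovVec μ e0 z w) ∧
    -- unnormalized vectors through normalized ones
    (∀ z w η : ℂ, ‖w‖ < 1 →
      η = (z + (starRingEnd ℂ) z * w) / (1 - w * (starRingEnd ℂ) w) →
      π.perelomovVec μ e0 z w =
        ((((1 - ‖w‖ ^ 2) ^ (-k) : ℝ) : ℂ) *
          Complex.exp ((1 / 2) * μ * (starRingEnd ℂ) η * z)) • π.normalizedVec μ e0 η w) ∧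
    -- `FC` is a change of variables of the Siegel-Jacobi disk, with inverse `FCinv`
    (Set.BijOn SiegelJacobi.FC SiegelJacobi.disk SiegelJacobi.disk ∧
      Set.InvOn SiegelJacobi.FCinv SiegelJacobi.FC SiegelJacobi.disk SiegelJacobi.disk ∧
      ContDiffOn ℝ ∞ SiegelJacobi.FC SiegelJacobi.disk ∧
      ContDiffOn ℝ ∞ SiegelJacobi.FCinv SiegelJacobi.disk) ∧
    -- it carries the normalized vectors to the normalizations of the Perelomov vectors:
    -- both are unit vectors, equal up to the explicit phase factor
    (∀ η w z w' : ℂ, ‖w‖ < 1 → (z, w') = SiegelJacobi.FC (η, w) →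
      ‖π.normalizedVec μ e0 η w‖ = 1 ∧ ‖π.perelomovUnit μ e0 z w'‖ = 1 ∧
      π.normalizedVec μ e0 η w =
        Complex.exp (-(1 / 2) * Complex.I * μ * (((starRingEnd ℂ) η * z).im : ℂ)) •
          π.perelomovUnit μ e0 z w') := by
  have hpos {w : ℂ} (hw : ‖w‖ < 1) : 0 < 1 - ‖w‖ ^ 2 := by nlinarith [norm_nonneg w]
  have hmain := fun (η w : ℂ) (hw : ‖w‖ < 1) => π.normalizedVec_eq hk he0 hμ η hw
  have hexp (x y : ℂ) (h : x + y = 0) : Complex.exp x * Complex.exp y = 1 := by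
    rw [← Complex.exp_add, h, Complex.exp_zero]
  have hmapsTo : Set.MapsTo SiegelJacobi.FC SiegelJacobi.disk SiegelJacobi.disk := fun _ hp => hp
  have hmapsTo' : Set.MapsTo SiegelJacobi.FCinv SiegelJacobi.disk SiegelJacobi.disk :=
    fun _ hp => hp
  have hinv : Set.InvOn SiegelJacobi.FCinv SiegelJacobi.FC SiegelJacobi.disk SiegelJacobi.disk :=
    ⟨fun _ hp => SiegelJacobi.FCinv_FC hp, fun _ hp => SiegelJacobi.FC_FCinv hp⟩
  refine ⟨fun z w hw => SiegelJacobi.DerivedRep.summable_perelomovTerm hk he0 μ z hw, ?_, ?_,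
    ⟨hinv.bijOn hmapsTo hmapsTo', hinv, SiegelJacobi.contDiff_FC.contDiffOn,
      SiegelJacobi.contDiffOn_FCinv⟩, ?_⟩
  · rintro η w z hw rfl
    exact hmain η w hw
  · intro z w η hw hη
    have hz : η - w * (starRingEnd ℂ) η = z := by
      have h := SiegelJacobi.FC_FCinv (p := (z, w)) hw
      rw [hη]
      exact congrArg Prod.fst h
    have h := hmain η w hw
    rw [hz] at h
    have hr : (((1 - ‖w‖ ^ 2) ^ (-k) : ℝ) : ℂ) * (((1 - ‖w‖ ^ 2) ^ k : ℝ) : ℂ) = 1 := by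
      rw [← Complex.ofReal_mul, ← Real.rpow_add (hpos hw), neg_add_cancel, Real.rpow_zero,
        Complex.ofReal_one]
    rw [h, smul_smul, mul_mul_mul_comm, hr, hexp _ _ (by ring), one_mul, one_smul]
  · intro η w z w' hw hFC
    obtain ⟨hz, hw'⟩ := Prod.mk.inj hFC
    obtain rfl : w = w' := hw'.symm
    have h := hmain η w hw
    have hn := π.norm_normalizedVec he0 μ η w
    change z = η - w * (starRingEnd ℂ) η at hz
    rw [← hz] at h
    set v := π.perelomovVec μ e0 z w with hv
    set x : ℂ := (starRingEnd ℂ) η * z with hx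
    have hc : 0 < (1 - ‖w‖ ^ 2) ^ k := Real.rpow_pos_of_pos (hpos hw) k
    -- The real part of the exponent goes into the normalization and the imaginary part is the
    -- phase.
    have hre : (-(1 / 2) * μ * (starRingEnd ℂ) η * z : ℂ) =
        ((-(1 / 2) * μ * x.re : ℝ) : ℂ) + -(1 / 2) * Complex.I * μ * (x.im : ℂ) := by
      rw [mul_assoc, ← hx]
      nth_rewrite 1 [← Complex.re_add_im x]
      push_cast
      ring
    have him : ‖Complex.exp (-(1 / 2) * Complex.I * μ * (x.im : ℂ))‖ = 1 := by
      have : (-(1 / 2) * Complex.I * μ * (x.im : ℂ)) =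
          ((-(1 / 2) * μ * x.im : ℝ) : ℂ) * Complex.I := by
        push_cast
        ring
      rw [this, Complex.norm_exp_ofReal_mul_I]
    rw [hre, Complex.exp_add, ← Complex.ofReal_exp] at h
    -- Taking norms in the first formula identifies the positive factor with ‖v‖⁻¹, since the left
    -- side is a unit vector and the phase has modulus 1.
    have hvn : (1 - ‖w‖ ^ 2) ^ k * Real.exp (-(1 / 2) * μ * x.re) * ‖v‖ = 1 := by
      rw [h, norm_smul, norm_mul, norm_mul, him, Complex.norm_real, Complex.norm_real,
        Real.norm_of_nonneg hc.le, Real.norm_of_nonneg (Real.exp_nonneg _), mul_one] at hn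
      exact hn
    have hv0 : ‖v‖ ≠ 0 := right_ne_zero_of_mul_eq_one hvn
    refine ⟨hn, ?_, ?_⟩
    · rw [SiegelJacobi.DerivedRep.perelomovUnit, ← hv, norm_smul, Complex.norm_real, norm_inv,
        norm_norm, inv_mul_cancel₀ hv0]
    · rw [SiegelJacobi.DerivedRep.perelomovUnit, ← hv, ← eq_inv_of_mul_eq_one_left hvn, h,
        smul_smul]
      congr 1
      push_cast
      ring
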